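/- **Theorem 3.3.** Let $\mathcal X,\mathcal Y,\mathcal Z,\widetilde{\mathcal Z},\mathfrak Z$ be finite-dimensional real Hilbert spaces, and let $\Gamma_0(\mathcal H)$ denote the set of proper lower semicontinuous convex functions $\varphi:\mathcal H\to(-\infty,\infty]$, with $\operatorname{dom}\varphi=\{x\mid\varphi(x)<\infty\}$. For $\varphi\in\Gamma_0(\mathcal H)$ put $\operatorname{rec}(\varphi)(x)=\sup_{v\in\operatorname{dom}\varphi}(\varphi(v+x)-\varphi(v))$, and call $\varphi$ *coercive* if $\operatorname{rec}(\varphi)(x)>0$ for all $x\neq 0$. Let $A:\mathcal X\to\mathcal Y$, $\mathfrak L:\mathcal X\to\mathcal Z$, $B:\mathcal Z\to\widetilde{\mathcal Z}$, $\mathfrak C:\mathcal X\to\mathfrak Z$ be linear, $\mu>0$, $f\in\Gamma_0(\mathcal Y)$ with $\operatorname{dom} f=\mathcal Y$ (differentiability of $f$ is not required), $\Psi\in\Gamma_0(\mathcal Z)$ coercive, and $\Delta\subset\mathfrak Z$ closed and convex, with $\operatorname{dom}(\Psi\circ\mathfrak L)\cap\mathfrak C^{-1}(\Delta)\neq\emptyset$,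 where $\mathfrak C^{-1}(\Delta)=\{x\in\mathcal X\mid\mathfrak Cx\in\Delta\}$. Define $$\Psi_B(z)=\Psi(z)-\min_{v\in\mathcal Z}\Big[\Psi(v)+\tfrac12\|B(z-v)\|^2\Big],\qquad J(x)=f(Ax)+\mu\,\Psi_B(\mathfrak Lx).$$ Assume the overall convexity condition $(C_1)$: $f\circ A$ is $\mu$-strongly convex relative to $x\mapsto\frac12\langle\mathfrak L^*B^*B\mathfrak Lx,x\rangle$, that is, the function $x\mapsto f(Ax)-\frac{\mu}{2}\|B\mathfrak Lx\|^2$ is convex on $\mathcal X$. Call a set *asymptotically multipolyhedral* if it equals $S+K$ for some compact set $S$ and some polyhedral cone $K$; here a cone is a set $K$ with $\alpha x\in K$ for all $x\in K$ and $\alpha>0$, and a polyhedral set is a finite intersection of closed half-spaces. Then the problem $\min_{\mathfrak Cx\in\Delta}J(x)$ has a minimizer, i.e. there is $x^\star\in\mathfrak C^{-1}(\Delta)$ with $J(x^\star)\le J(x)$ for all $x\in\mathfrak C^{-1}(\Delta)$, if any one of the following holds: (i) $f$ is coercive and $\mathfrak C^{-1}(\Delta)$ is asymptotically multipolyhedral;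 (ii) $f$ is coercive and $\operatorname{null}A\cap\operatorname{null}\mathfrak L=\{0\}$; (iii) $f$ is bounded below and $\operatorname{null}\mathfrak L=\{0\}$; (iv) $\mathfrak C^{-1}(\Delta)$ is bounded. -/

import Mathlib

open scoped Pointwise

namespace CLiGME

noncomputable section

/-- The effective domain `dom φ = {x | φ x < ∞}`. -/
def dom {H : Type*} (φ : H → EReal) : Set H :=
  {x | φ x < ⊤}

/-- Convexity of an extended-real-valued function. It is used for functions with values in
`(-∞, ∞]`, for which the right-hand side below is a sum of two real numbers. -/
def IsConvex {H : Type*} [AddCommGroup H] [Module ℝ H] (φ : H → EReal) : Prop :=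
  ∀ x ∈ dom φ, ∀ y ∈ dom φ, ∀ t : ℝ, 0 < t → t < 1 →
    φ (t • x + (1 - t) • y) ≤ (t : EReal) * φ x + ((1 - t : ℝ) : EReal) * φ y

/-- The class `Γ₀(H)`: functions `H → (-∞, ∞]` that are proper, lower semicontinuous and convex. -/
structure IsGammaZero {H : Type*} [NormedAddCommGroup H] [InnerProductSpace ℝ H]
    (φ : H → EReal) : Prop where
  ne_bot : ∀ x, φ x ≠ ⊥
  proper : (dom φ).Nonempty
  lsc : LowerSemicontinuous φ
  convex : IsConvex φ

/-- The recession function `rec φ (x) = sup_{v ∈ dom φ} (φ (v + x) - φ v)`. -/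
def recession {H : Type*} [AddCommGroup H] (φ : H → EReal) (x : H) : EReal :=
  ⨆ v ∈ dom φ, (φ (v + x) - φ v)

/-- Coercivity: the recession function is positive away from the origin. -/
def IsCoercive {H : Type*} [AddCommGroup H] (φ : H → EReal) : Prop :=
  ∀ x : H, x ≠ 0 → 0 < recession φ x

/-- Boundedness below by a real constant. -/
def IsBoundedBelow {H : Type*} (φ : H → EReal) : Prop :=
  ∃ m : ℝ, ∀ x, (m : EReal) ≤ φ x

/-- The quadratic function `q_M x = (1/2) ⟪M x, x⟫`. -/
def quad {H : Type*} [NormedAddCommGroup H] [InnerProductSpace ℝ H]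
    (M : H →ₗ[ℝ] H) (x : H) : ℝ :=
  (1 / 2) * inner ℝ (M x) x

/-- `φ` is `α`-strongly convex relative to `q_M`: the function `φ - α q_M` is convex. -/
def IsStronglyConvexRel {H : Type*} [NormedAddCommGroup H] [InnerProductSpace ℝ H]
    (α : ℝ) (M : H →ₗ[ℝ] H) (φ : H → EReal) : Prop :=
  IsConvex fun x => φ x - ((α * quad M x : ℝ) : EReal)

/-- The generalized Moreau enhanced function
`Ψ_B z = Ψ z - min_v [Ψ v + (1/2) ‖B (z - v)‖²]`. The minimum is written as the infimum in the
extended reals, which equals it whenever it is attained. -/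
def gme {Z W : Type*} [NormedAddCommGroup Z] [InnerProductSpace ℝ Z]
    [NormedAddCommGroup W] [InnerProductSpace ℝ W]
    (Ψ : Z → EReal) (B : Z →ₗ[ℝ] W) (z : Z) : EReal :=
  Ψ z - ⨅ v : Z, (Ψ v + (((1 / 2) * ‖B (z - v)‖ ^ 2 : ℝ) : EReal))

/-- The cost function `J = f ∘ A + μ Ψ_B ∘ L`. -/
def cost {X Y Z W : Type*} [NormedAddCommGroup X] [InnerProductSpace ℝ X]
    [NormedAddCommGroup Y] [InnerProductSpace ℝ Y]
    [NormedAddCommGroup Z] [InnerProductSpace ℝ Z]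
    [NormedAddCommGroup W] [InnerProductSpace ℝ W]
    (f : Y → EReal) (A : X →ₗ[ℝ] Y) (μ : ℝ) (Ψ : Z → EReal) (B : Z →ₗ[ℝ] W) (L : X →ₗ[ℝ] Z)
    (x : X) : EReal :=
  f (A x) + (μ : EReal) * gme Ψ B (L x)

/-- The overall convexity condition: `f ∘ A` is `μ`-strongly convex relative to `q_{L* B* B L}`. -/
def OverallConvexity {X Y Z W : Type*}
    [NormedAddCommGroup X] [InnerProductSpace ℝ X] [FiniteDimensional ℝ X]
    [NormedAddCommGroup Y] [InnerProductSpace ℝ Y]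
    [NormedAddCommGroup Z] [InnerProductSpace ℝ Z] [FiniteDimensional ℝ Z]
    [NormedAddCommGroup W] [InnerProductSpace ℝ W] [FiniteDimensional ℝ W]
    (f : Y → EReal) (A : X →ₗ[ℝ] Y) (μ : ℝ) (B : Z →ₗ[ℝ] W) (L : X →ₗ[ℝ] Z) : Prop :=
  IsStronglyConvexRel μ
    (LinearMap.adjoint L ∘ₗ LinearMap.adjoint B ∘ₗ B ∘ₗ L) (fun x => f (A x))

/-- A polyhedral set: a finite intersection of closed half-spaces. -/
def IsPolyhedral {H : Type*} [NormedAddCommGroup H] [InnerProductSpace ℝ H]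
    (K : Set H) : Prop :=
  ∃ (n : ℕ) (a : Fin n → H) (b : Fin n → ℝ),
    (∀ i, a i ≠ 0) ∧ K = {x | ∀ i, inner ℝ (a i) x ≤ b i}

/-- A cone: a set stable under multiplication by positive scalars. -/
def IsCone {H : Type*} [AddCommGroup H] [Module ℝ H] (K : Set H) : Prop :=
  ∀ x ∈ K, ∀ t : ℝ, 0 < t → t • x ∈ K

/-- An asymptotically multipolyhedral set: the Minkowski sum of a compact set and a
polyhedral cone. -/
def IsAsymptoticallyMultipolyhedral {H : Type*} [NormedAddCommGroup H] [InnerProductSpace ℝ H]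
    (C : Set H) : Prop :=
  ∃ S K : Set H, IsCompact S ∧ IsPolyhedral K ∧ IsCone K ∧ C = S + K

end

end CLiGME

/-! The cost `J` splits as `(f ∘ A - (μ/2)‖B L ·‖²) + μ Ψ ∘ L + μ ((1/2)‖B L ·‖² - env ∘ L)`, where
`env` is the Moreau envelope. The first term is convex by the overall convexity condition, the last
because `env - (1/2)‖B ·‖²` is an infimum of affine functions. So `J` is lower semicontinuous with
convex sublevel sets, and a minimizer exists once no nontrivial ray of the feasible set `D` stays in
a sublevel set (`exists_isMinOn_of_ray`).

If `f` is bounded below, `J` bounded above on a ray with direction `d` forces `L d = 0`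
(`OverallConvexity.ray_of_cost_le`); this settles (iii). If `f` is coercive, also `A d = 0`, so `d`
lies in `N = ker A ⊓ ker L`. Since `J` is invariant under `N`, it can be minimized modulo `N`,
provided `D + N` is closed: in (ii) `N` is trivial, in (i) closedness comes from Fourier–Motzkin
elimination. In (iv) `D` contains no ray. -/

namespace CLiGME

open Filter Topology Submodule

/-! ### Closedness of polyhedral sets modulo a subspace -/

section Polyhedral

variable {H : Type*} [NormedAddCommGroup H] [InnerProductSpace ℝ H]

/-- The solution set of finitely many weak linear inequalities, trivial ones being allowed. -/
def IsLinearSystem (K : Set H) : Prop :=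
  ∃ (ι : Type) (_ : Finite ι) (a : ι → H) (b : ι → ℝ), K = {x | ∀ i, inner ℝ (a i) x ≤ b i}

theorem IsPolyhedral.isLinearSystem {K : Set H} (hK : IsPolyhedral K) : IsLinearSystem K := by
  obtain ⟨n, a, b, -, rfl⟩ := hK
  exact ⟨Fin n, inferInstance, a, b, rfl⟩

theorem IsLinearSystem.isClosed {K : Set H} (hK : IsLinearSystem K) : IsClosed K := by
  obtain ⟨ι, _, a, b, rfl⟩ := hK
  rw [Set.ofPred_forall]
  exact isClosed_iInter fun i => isClosed_le (by fun_prop) continuous_const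

/-- Fourier–Motzkin elimination of one direction. -/
theorem IsLinearSystem.add_span_singleton {K : Set H} (hK : IsLinearSystem K) (v : H) :
    IsLinearSystem (K + (ℝ ∙ v : Set H)) := by
  obtain ⟨ι, _, a, b, rfl⟩ := hK
  let I := {i // inner ℝ (a i) v = 0}
  let P := {i // 0 < inner ℝ (a i) v}
  let N := {i // inner ℝ (a i) v < 0}
  refine ⟨I ⊕ (P × N), inferInstance,
    Sum.elim (fun i => a i) fun q =>
      inner ℝ (a q.1) v • a q.2 - inner ℝ (a q.2) v • a q.1,
    Sum.elim (fun i => b i) fun q =>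
      inner ℝ (a q.1) v * b q.2 - inner ℝ (a q.2) v * b q.1, ?_⟩
  ext x
  simp only [Set.mem_add, Set.mem_ofPred_eq, SetLike.mem_coe, mem_span_singleton, Sum.forall,
    Sum.elim_inl, Sum.elim_inr, inner_sub_left, real_inner_smul_left]
  constructor
  · rintro ⟨y, hy, _, ⟨t, rfl⟩, rfl⟩
    refine ⟨fun i => ?_, fun q => ?_⟩
    · simpa [inner_add_right, real_inner_smul_right, i.2] using hy i
    · have h1 := mul_le_mul_of_nonneg_left (hy q.2) q.1.2.le
      have h2 := mul_le_mul_of_nonpos_left (hy q.1) q.2.2.le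
      simp only [inner_add_right, real_inner_smul_right]
      linarith
  · rintro ⟨h0, hpn⟩
    -- Constraint `i` at `x - t • v` reads `r i ≤ t` for `i` in `P` and `t ≤ r i` for `i` in `N`;
    -- the combined inequalities say that every lower bound is at most every upper bound.
    let r : ι → ℝ := fun i => (inner ℝ (a i) x - b i) / inner ℝ (a i) v
    have key : ∃ t : ℝ, (∀ i : P, r i ≤ t) ∧ ∀ j : N, t ≤ r j := by
      have hle : ∀ (i : P) (j : N), r i ≤ r j := by
        intro i j
        have hj := j.2
        have hi := i.2
        have hij := hpn (i, j)
        simp only at hij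
        have h1 : r j = (b j - inner ℝ (a j) x) / (-inner ℝ (a j) v) := by
          simp only [r]
          rw [div_neg, ← neg_div, neg_sub]
        rw [h1]
        simp only [r]
        rw [div_le_div_iff₀ hi (by linarith)]
        linarith
      rcases isEmpty_or_nonempty P with hP | hP
      · obtain ⟨t, ht⟩ := (Set.finite_range fun j : N => r j).bddBelow
        exact ⟨t, fun i => hP.elim i, fun j => ht ⟨j, rfl⟩⟩
      · refine ⟨⨆ i : P, r i, fun i => ?_, fun j => ciSup_le fun i => hle i j⟩
        exact le_ciSup (Set.finite_range fun i : P => r i).bddAbove i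
    obtain ⟨t, hP, hN⟩ := key
    refine ⟨x - t • v, fun i => ?_, t • v, ⟨t, rfl⟩, by simp⟩
    rw [inner_sub_right, real_inner_smul_right]
    rcases lt_trichotomy (inner ℝ (a i) v) 0 with hi | hi | hi
    · have := (le_div_iff_of_neg hi).1 (hN ⟨i, hi⟩)
      linarith
    · simpa [hi] using h0 ⟨i, hi⟩
    · have := (div_le_iff₀ hi).1 (hP ⟨i, hi⟩)
      linarith

theorem IsLinearSystem.add_submodule [FiniteDimensional ℝ H] (N : Submodule ℝ H) :
    ∀ {K : Set H}, IsLinearSystem K → IsLinearSystem (K + (N : Set H)) := by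
  induction N, IsNoetherian.noetherian N using Submodule.fg_induction with
  | singleton x => exact fun hK => hK.add_span_singleton x
  | sup N₁ N₂ _ _ h₁ h₂ =>
    intro K hK
    rw [coe_sup, ← add_assoc]
    exact h₂ (h₁ hK)

/-- For a general closed convex set this fails. Here the polyhedral part plus `N` is again a linear
system, hence closed, and adding a compact set preserves closedness. -/
theorem IsAsymptoticallyMultipolyhedral.isClosed_add_submodule [FiniteDimensional ℝ H]
    {D : Set H} (hD : IsAsymptoticallyMultipolyhedral D) (N : Submodule ℝ H) :
    IsClosed (D + (N : Set H)) := by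
  obtain ⟨S, K, hS, hK, -, rfl⟩ := hD
  rw [add_assoc]
  exact (hK.isLinearSystem.add_submodule N).isClosed.add_left_of_isCompact hS

end Polyhedral

/-! ### Existence of minimizers modulo a subspace of invariance -/

section Minimizer

variable {H : Type*} [NormedAddCommGroup H] [InnerProductSpace ℝ H] [FiniteDimensional ℝ H]

/-- A lower semicontinuous function invariant under `N` attains its minimum on a convex set `D`
with `D + N` closed, if no ray from `x₀ ∈ D` in a direction orthogonal to `N` stays in `D + N` and
in the (convex) sublevel set of `x₀`. -/
theorem exists_isMinOn_of_ray {φ : H → EReal} (hφ : LowerSemicontinuous φ) (N : Submodule ℝ H)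
    (hN : ∀ x, ∀ n ∈ N, φ (x + n) = φ x) {D : Set H} (hD : Convex ℝ D)
    (hDN : IsClosed (D + (N : Set H))) {x₀ : H} (hx₀ : x₀ ∈ D)
    (hconv : Convex ℝ {x | φ x ≤ φ x₀})
    (hray : ∀ d ∈ Nᗮ, (∀ t : ℝ, 0 ≤ t → x₀ + t • d ∈ D + (N : Set H)) →
      (∀ t : ℝ, 0 ≤ t → φ (x₀ + t • d) ≤ φ x₀) → d = 0) :
    ∃ x ∈ D, IsMinOn φ D x := by
  have split : ∀ x : H, ∃ p ∈ Nᗮ, ∃ n ∈ N, x + n = p := fun x => by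
    obtain ⟨n, hn, p, hp, rfl⟩ := N.exists_add_mem_mem_orthogonal x
    exact ⟨p, hp, -n, N.neg_mem hn, by abel⟩
  have sub_add : ∀ x ∈ D + (N : Set H), ∀ n ∈ N, x + n ∈ D + (N : Set H) := by
    rintro _ ⟨d, hd, m, hm, rfl⟩ n hn
    exact ⟨d, hd, m + n, N.add_mem hm hn, by simp [add_assoc]⟩
  have self_mem : ∀ x ∈ D, x ∈ D + (N : Set H) := fun x hx => ⟨x, hx, 0, N.zero_mem, by simp⟩
  obtain ⟨p₀, hp₀, n₀, hn₀, hpn⟩ := split x₀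
  -- Each class modulo `N` has one representative in `Nᗮ`, so minimizing over `T` loses nothing. `T`
  -- is closed and convex, hence compact once its asymptotic cone is trivial.
  set T : Set H := (D + (N : Set H)) ∩ (Nᗮ : Set H) ∩ {x | φ x ≤ φ x₀} with hT
  have hTconv : Convex ℝ T :=
    ((hD.add N.convex).inter Nᗮ.convex).inter hconv
  have hTclosed : IsClosed T :=
    (hDN.inter (Submodule.closed_of_finiteDimensional _)).inter (hφ.isClosed_preimage _)
  have hp₀T : p₀ ∈ T :=
    ⟨⟨hpn ▸ sub_add _ (self_mem _ hx₀) _ hn₀, hp₀⟩, by simp [← hpn, hN x₀ n₀ hn₀]⟩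
  have hTb : Bornology.IsBounded T := by
    rw [isBounded_iff_asymptoticCone_subset_singleton]
    intro d hd
    have hmem : ∀ t : ℝ, 0 ≤ t → p₀ + t • d ∈ T := fun t ht => by
      have := hTconv.smul_vadd_mem_of_isClosed_of_mem_asymptoticCone hTclosed ht hd hp₀T
      rwa [vadd_eq_add, add_comm] at this
    have hdN : d ∈ Nᗮ := by
      have := Nᗮ.sub_mem (hmem 1 zero_le_one).1.2 hp₀
      simpa using this
    have hshift : ∀ t : ℝ, x₀ + t • d = p₀ + t • d + -n₀ := fun t => by rw [← hpn]; abel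
    refine hray d hdN (fun t ht => ?_) fun t ht => ?_
    · rw [hshift]
      exact sub_add _ (hmem t ht).1.1 _ (N.neg_mem hn₀)
    · rw [hshift, hN _ _ (N.neg_mem hn₀)]
      exact (hmem t ht).2
  obtain ⟨p, hp, hmin⟩ := LowerSemicontinuousOn.exists_isMinOn ⟨p₀, hp₀T⟩
    (Metric.isCompact_of_isClosed_isBounded hTclosed hTb) (hφ.lowerSemicontinuousOn T)
  obtain ⟨x, hx, n, hn, hxn⟩ := hp.1.1
  have hpx : φ p = φ x := hxn ▸ hN x n hn
  refine ⟨x, hx, fun y hy => ?_⟩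
  rw [Set.mem_ofPred_eq, ← hpx]
  rcases le_total (φ y) (φ x₀) with h | h
  · obtain ⟨q, hq, m, hm, hqm⟩ := split y
    have hqy : φ q = φ y := hqm ▸ hN y m hm
    refine (hmin ?_ : φ p ≤ φ q).trans hqy.le
    exact ⟨⟨hqm ▸ sub_add _ (self_mem _ hy) _ hm, hq⟩, (hqy.trans_le h : φ q ≤ φ x₀)⟩
  · exact hp.2.trans h

end Minimizer

/-! ### Recession and coercivity -/

section Recession

theorem mem_dom {α : Type*} {φ : α → EReal} {x : α} : x ∈ dom φ ↔ φ x < ⊤ := Iff.rfl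

variable {H : Type*} [NormedAddCommGroup H] [InnerProductSpace ℝ H] {φ : H → EReal}

theorem IsGammaZero.coe_toReal (hφ : IsGammaZero φ) {x : H} (hx : x ∈ dom φ) :
    ((φ x).toReal : EReal) = φ x :=
  EReal.coe_toReal (ne_of_lt hx) (hφ.ne_bot x)

theorem IsGammaZero.toReal_le (hφ : IsGammaZero φ) {x : H} {c : ℝ} (h : φ x ≤ c) :
    (φ x).toReal ≤ c := by
  rw [← EReal.coe_le_coe_iff, hφ.coe_toReal (h.trans_lt (EReal.coe_lt_top c))]
  exact h

theorem IsGammaZero.le_toReal (hφ : IsGammaZero φ) {x y : H} (hx : x ∈ dom φ) (hy : y ∈ dom φ)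
    {t : ℝ} (h0 : 0 < t) (h1 : t < 1) :
    φ (t • x + (1 - t) • y) ≤ ((t * (φ x).toReal + (1 - t) * (φ y).toReal : ℝ) : EReal) := by
  have := hφ.convex x hx y hy t h0 h1
  rw [← hφ.coe_toReal hx, ← hφ.coe_toReal hy] at this
  exact_mod_cast this

theorem IsGammaZero.convex_sublevel (hφ : IsGammaZero φ) (c : ℝ) :
    Convex ℝ {x | φ x ≤ c} := by
  refine convex_iff_forall_pos.2 fun x hx y hy a b ha hb hab => ?_
  obtain rfl : b = 1 - a := by linarith
  refine (hφ.le_toReal (hx.trans_lt (EReal.coe_lt_top c)) (hy.trans_lt (EReal.coe_lt_top c))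
    ha (by linarith)).trans ?_
  have h1 := mul_le_mul_of_nonneg_left (hφ.toReal_le hx) ha.le
  have h2 := mul_le_mul_of_nonneg_left (hφ.toReal_le hy) hb.le
  exact_mod_cast (by linarith)

/-- A coercive function in `Γ₀` is unbounded above on every ray. -/
theorem IsGammaZero.eq_zero_of_ray_le (hφ : IsGammaZero φ) (hc : IsCoercive φ) {x d : H} {c : ℝ}
    (h : ∀ t : ℝ, 0 ≤ t → φ (x + t • d) ≤ c) : d = 0 := by
  by_contra hd
  refine (hc d hd).not_ge (iSup₂_le fun v hv => ?_)
  rw [EReal.sub_nonpos]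
  -- Convexity between `v` and the ray point `x + n • d`, with weight `n⁻¹` on the latter. As `n →
  -- ∞` the combination tends to `v + d` and the bound to `φ v`, so semicontinuity gives `φ (v + d)
  -- ≤ φ v`.
  have hle : ∀ n : ℝ, 1 < n → φ ((1 - n⁻¹) • v + n⁻¹ • x + d) ≤
      (((1 - n⁻¹) * (φ v).toReal + n⁻¹ * c : ℝ) : EReal) := by
    intro n hn
    have hn0 : 0 < n := by linarith
    have hxn := h n hn0.le
    have := hφ.le_toReal (hxn.trans_lt (EReal.coe_lt_top c)) hv (inv_pos.2 hn0)
      (inv_lt_one_of_one_lt₀ hn)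
    have e : n⁻¹ • (x + n • d) + (1 - n⁻¹) • v = (1 - n⁻¹) • v + n⁻¹ • x + d := by
      rw [smul_add, smul_smul, inv_mul_cancel₀ hn0.ne', one_smul]; abel
    rw [e] at this
    refine this.trans ?_
    have h2 := mul_le_mul_of_nonneg_left (hφ.toReal_le hxn) (inv_pos.2 hn0).le
    exact_mod_cast (by linarith)
  have hinv : Tendsto (fun n : ℝ => n⁻¹) atTop (𝓝 0) := tendsto_inv_atTop_zero
  have hx : Tendsto (fun n : ℝ => (1 - n⁻¹) • v + n⁻¹ • x + d) atTop (𝓝 (v + d)) := by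
    have := (((tendsto_const_nhds (x := (1 : ℝ))).sub hinv).smul_const v).add
      (hinv.smul_const x) |>.add_const d
    simpa using this
  have hr : Tendsto (fun n : ℝ => (1 - n⁻¹) * (φ v).toReal + n⁻¹ * c) atTop
      (𝓝 (φ v).toReal) := by
    have := (((tendsto_const_nhds (x := (1 : ℝ))).sub hinv).mul_const (φ v).toReal).add
      (hinv.mul_const c)
    simpa using this
  rw [← hφ.coe_toReal hv, ← EReal.le_of_forall_lt_iff_le]
  intro s hs
  have hs' : (φ v).toReal < s := by exact_mod_cast hs
  refine isClosed_iff_frequently.1 (hφ.lsc.isClosed_preimage (s : EReal)) _ (hx.frequently ?_)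
  refine Eventually.frequently ?_
  filter_upwards [hr.eventually_lt_const hs', eventually_gt_atTop 1] with n h1 h2
  exact (hle n h2).trans (EReal.coe_le_coe_iff.2 h1.le)

theorem IsGammaZero.isBoundedBelow [FiniteDimensional ℝ H] (hφ : IsGammaZero φ)
    (hc : IsCoercive φ) : IsBoundedBelow φ := by
  obtain ⟨x₀, hx₀⟩ := hφ.proper
  obtain ⟨x, -, hx⟩ := exists_isMinOn_of_ray hφ.lsc ⊥ (by simp) convex_univ (by simp)
    (Set.mem_univ x₀) (hφ.coe_toReal hx₀ ▸ hφ.convex_sublevel _) fun d _ _ h =>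
      hφ.eq_zero_of_ray_le hc fun t ht => (h t ht).trans (hφ.coe_toReal hx₀).ge
  have hle : φ x ≤ φ x₀ := hx (Set.mem_univ x₀)
  have hxd : x ∈ dom φ := hle.trans_lt hx₀
  exact ⟨(φ x).toReal, fun y => (hφ.coe_toReal hxd).trans_le (hx (Set.mem_univ y))⟩

end Recession
-- The generalized Moreau envelope
section Envelope

variable {Z W : Type*} [NormedAddCommGroup Z] [InnerProductSpace ℝ Z]
  [NormedAddCommGroup W] [InnerProductSpace ℝ W]

/-- The generalized Moreau envelope, which is subtracted from `Ψ` in `gme Ψ B`. -/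
noncomputable def moreauEnvelope (Ψ : Z → EReal) (B : Z →ₗ[ℝ] W) (z : Z) : EReal :=
  ⨅ v : Z, (Ψ v + (((1 / 2) * ‖B (z - v)‖ ^ 2 : ℝ) : EReal))

theorem norm_sq_convexCombination (u w : W) {a b : ℝ} (hab : a + b = 1) :
    ‖a • u + b • w‖ ^ 2 = a * ‖u‖ ^ 2 + b * ‖w‖ ^ 2 - a * b * ‖u - w‖ ^ 2 := by
  obtain rfl : b = 1 - a := by linarith
  rw [norm_add_sq_real, norm_sub_sq_real, norm_smul, norm_smul, mul_pow, mul_pow,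
    real_inner_smul_left, real_inner_smul_right, Real.norm_eq_abs, Real.norm_eq_abs, sq_abs,
    sq_abs]
  ring

variable {Ψ : Z → EReal} {B : Z →ₗ[ℝ] W}

theorem moreauEnvelope_congr {z w : Z} (h : B z = B w) :
    moreauEnvelope Ψ B z = moreauEnvelope Ψ B w := by
  simp only [moreauEnvelope, map_sub, h]

theorem moreauEnvelope_le_self (z : Z) : moreauEnvelope Ψ B z ≤ Ψ z :=
  (iInf_le _ z).trans (by simp)

theorem upperSemicontinuous_moreauEnvelope [FiniteDimensional ℝ Z] :
    UpperSemicontinuous (moreauEnvelope Ψ B) := by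
  refine upperSemicontinuous_iInf fun v => ?_
  have hB : Continuous B := B.continuous_of_finiteDimensional
  refine UpperSemicontinuous.add' upperSemicontinuous_const
    (continuous_coe_real_ereal.comp (by fun_prop)).upperSemicontinuous fun z => ?_
  exact EReal.continuousAt_add (.inr (EReal.coe_ne_bot _)) (.inr (EReal.coe_ne_top _))

theorem IsGammaZero.coe_moreauEnvelope (hΨ : IsGammaZero Ψ) (hb : IsBoundedBelow Ψ) (z : Z) :
    ((moreauEnvelope Ψ B z).toReal : EReal) = moreauEnvelope Ψ B z := by
  obtain ⟨v, hv⟩ := hΨ.proper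
  obtain ⟨m, hm⟩ := hb
  refine EReal.coe_toReal (ne_of_lt ?_) (ne_of_gt ?_)
  · refine (iInf_le _ v).trans_lt ?_
    rw [← hΨ.coe_toReal hv]
    exact_mod_cast EReal.coe_lt_top _
  · refine (EReal.bot_lt_coe m).trans_le (le_iInf fun v => (hm v).trans ?_)
    exact le_add_of_nonneg_right (by exact_mod_cast by positivity)

theorem IsGammaZero.moreauEnvelope_toReal_le (hΨ : IsGammaZero Ψ) (hb : IsBoundedBelow Ψ) (z : Z)
    {v : Z} (hv : v ∈ dom Ψ) :
    (moreauEnvelope Ψ B z).toReal ≤ (Ψ v).toReal + 1 / 2 * ‖B (z - v)‖ ^ 2 := by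
  rw [← EReal.coe_le_coe_iff, hΨ.coe_moreauEnvelope hb, EReal.coe_add, hΨ.coe_toReal hv]
  exact iInf_le _ v

theorem IsGammaZero.le_moreauEnvelope_toReal (hΨ : IsGammaZero Ψ) (hb : IsBoundedBelow Ψ) (z : Z)
    {c : ℝ} (hc : ∀ v ∈ dom Ψ, c ≤ (Ψ v).toReal + 1 / 2 * ‖B (z - v)‖ ^ 2) :
    c ≤ (moreauEnvelope Ψ B z).toReal := by
  rw [← EReal.coe_le_coe_iff, hΨ.coe_moreauEnvelope hb]
  refine le_iInf fun v => ?_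
  by_cases hv : v ∈ dom Ψ
  · rw [← hΨ.coe_toReal hv]
    exact_mod_cast hc v hv
  · rw [not_lt_top_iff.1 (mem_dom.not.1 hv), EReal.top_add_coe]
    exact le_top

/-- Subtracting `(1/2) ‖B ·‖²` from the generalized Moreau envelope leaves a concave function. -/
theorem IsGammaZero.moreauEnvelope_concave (hΨ : IsGammaZero Ψ) (hb : IsBoundedBelow Ψ) (z w : Z)
    {a b : ℝ} (ha : 0 ≤ a) (hb' : 0 ≤ b) (hab : a + b = 1) :
    a * (moreauEnvelope Ψ B z).toReal + b * (moreauEnvelope Ψ B w).toReal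
      - a * b / 2 * ‖B (z - w)‖ ^ 2 ≤ (moreauEnvelope Ψ B (a • z + b • w)).toReal := by
  -- The same `v` serves as competitor at `z`, at `w` and at their combination; the quadratic
  -- identity supplies exactly the correction term.
  refine hΨ.le_moreauEnvelope_toReal hb _ fun v hv => ?_
  have hz := mul_le_mul_of_nonneg_left (hΨ.moreauEnvelope_toReal_le (B := B) hb z hv) ha
  have hw := mul_le_mul_of_nonneg_left (hΨ.moreauEnvelope_toReal_le (B := B) hb w hv) hb'
  have e : B (a • z + b • w - v) = a • B (z - v) + b • B (w - v) := by
    obtain rfl : b = 1 - a := by linarith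
    simp only [map_sub, map_add, map_smul]
    module
  have e' : B (z - v) - B (w - v) = B (z - w) := by simp
  rw [e, norm_sq_convexCombination _ _ hab, e']
  obtain rfl : b = 1 - a := by linarith
  linarith

end Envelope

/-! ### Semicontinuity, convexity and rays of the cost -/

section Cost

variable {X Y Z W : Type*}
  [NormedAddCommGroup X] [InnerProductSpace ℝ X]
  [NormedAddCommGroup Y] [InnerProductSpace ℝ Y]
  [NormedAddCommGroup Z] [InnerProductSpace ℝ Z]
  [NormedAddCommGroup W] [InnerProductSpace ℝ W]
  {A : X →ₗ[ℝ] Y} {f : Y → EReal} {Ψ : Z → EReal} {μ : ℝ} {L : X →ₗ[ℝ] Z} {B : Z →ₗ[ℝ] W}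

theorem cost_eq_coe (hf : IsGammaZero f) (hfdom : dom f = Set.univ) (hΨ : IsGammaZero Ψ)
    (hb : IsBoundedBelow Ψ) {x : X} (hx : L x ∈ dom Ψ) :
    cost f A μ Ψ B L x = (((f (A x)).toReal +
      μ * ((Ψ (L x)).toReal - (moreauEnvelope Ψ B (L x)).toReal) : ℝ) : EReal) := by
  rw [EReal.coe_add, EReal.coe_mul, EReal.coe_sub, hf.coe_toReal (hfdom ▸ Set.mem_univ _),
    hΨ.coe_toReal hx, hΨ.coe_moreauEnvelope hb]
  rfl

theorem mem_dom_of_cost_lt_top (hf : IsGammaZero f) (hΨ : IsGammaZero Ψ) (hμ : 0 < μ)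
    (hb : IsBoundedBelow Ψ) {x : X} (hx : cost f A μ Ψ B L x < ⊤) : L x ∈ dom Ψ := by
  by_contra h
  refine hx.ne ?_
  have hg : gme Ψ B (L x) = ⊤ := by
    change Ψ (L x) - moreauEnvelope Ψ B (L x) = ⊤
    rw [not_lt_top_iff.1 (mem_dom.not.1 h), ← hΨ.coe_moreauEnvelope hb, EReal.top_sub_coe]
  rw [cost, hg, EReal.coe_mul_top_of_pos hμ, EReal.add_top_of_ne_bot (hf.ne_bot _)]

variable [FiniteDimensional ℝ X] [FiniteDimensional ℝ Z]

theorem lowerSemicontinuous_cost (hf : IsGammaZero f) (hΨ : IsGammaZero Ψ) (hμ : 0 < μ)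
    (hb : IsBoundedBelow Ψ) : LowerSemicontinuous (cost f A μ Ψ B L) := by
  have hA : Continuous A := A.continuous_of_finiteDimensional
  have hL : Continuous L := L.continuous_of_finiteDimensional
  have henv : ∀ z, moreauEnvelope Ψ B z ≠ ⊥ ∧ moreauEnvelope Ψ B z ≠ ⊤ := fun z => by
    rw [← hΨ.coe_moreauEnvelope hb]
    exact ⟨EReal.coe_ne_bot _, EReal.coe_ne_top _⟩
  have hneg : LowerSemicontinuous fun z => -moreauEnvelope Ψ B z :=
    continuous_neg.comp_upperSemicontinuous_antitone upperSemicontinuous_moreauEnvelope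
      EReal.neg_strictAnti.antitone
  have hgme : LowerSemicontinuous (gme Ψ B) := by
    refine hΨ.lsc.add' hneg fun z => EReal.continuousAt_add (.inr ?_) (.inl (hΨ.ne_bot z))
    exact fun h => (henv z).2 (EReal.neg_eq_bot_iff.1 h)
  have hgme_bot : ∀ z, gme Ψ B z ≠ ⊥ := fun z => by
    refine (lt_of_lt_of_le EReal.bot_lt_zero ?_).ne'
    exact (EReal.sub_nonneg (.inr (henv z).2) (.inr (henv z).1)).2 (moreauEnvelope_le_self z)
  have hmul : LowerSemicontinuous fun z => (μ : EReal) * gme Ψ B z := by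
    refine Continuous.comp_lowerSemicontinuous (g := fun t => (μ : EReal) * t) ?_ hgme
      (fun s t h => mul_le_mul_of_nonneg_left h (by exact_mod_cast hμ.le))
    exact continuous_iff_continuousAt.2 fun t =>
      EReal.Tendsto.const_mul tendsto_id (.inl (EReal.coe_ne_bot _)) (.inl (EReal.coe_ne_top _))
  refine (hf.lsc.comp hA).add' (hmul.comp hL) fun x =>
    EReal.continuousAt_add (.inr ?_) (.inl (hf.ne_bot _))
  have := hgme_bot (L x)
  rw [Ne, EReal.mul_eq_bot]
  simp [this, hμ.not_gt]

variable [FiniteDimensional ℝ W]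

theorem quad_adjoint_comp (x : X) :
    quad (LinearMap.adjoint L ∘ₗ LinearMap.adjoint B ∘ₗ B ∘ₗ L) x = 1 / 2 * ‖B (L x)‖ ^ 2 := by
  simp only [quad, LinearMap.comp_apply, LinearMap.adjoint_inner_left,
    real_inner_self_eq_norm_sq]

theorem OverallConvexity.toReal_le (hC1 : OverallConvexity f A μ B L) (hf : IsGammaZero f)
    (hfdom : dom f = Set.univ) (x y : X) {a b : ℝ} (ha : 0 < a) (hb : 0 < b) (hab : a + b = 1) :
    (f (A (a • x + b • y))).toReal ≤ a * (f (A x)).toReal + b * (f (A y)).toReal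
      - μ * (a * b / 2) * ‖B (L (x - y))‖ ^ 2 := by
  have hdom : ∀ y, y ∈ dom f := fun y => hfdom ▸ Set.mem_univ y
  obtain rfl : b = 1 - a := by linarith
  have hreal : ∀ x : X, f (A x) - ((μ * quad (LinearMap.adjoint L ∘ₗ LinearMap.adjoint B ∘ₗ
      B ∘ₗ L) x : ℝ) : EReal) = (((f (A x)).toReal - μ * (1 / 2 * ‖B (L x)‖ ^ 2) : ℝ) : EReal) := by
    intro x
    rw [quad_adjoint_comp, EReal.coe_sub, hf.coe_toReal (hdom _)]
  have mem : ∀ x : X, x ∈ dom fun x => f (A x) - ((μ * quad (LinearMap.adjoint L ∘ₗ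
      LinearMap.adjoint B ∘ₗ B ∘ₗ L) x : ℝ) : EReal) := fun x =>
    (hreal x).trans_lt (EReal.coe_lt_top _)
  have h := hC1 x (mem x) y (mem y) a ha (by linarith)
  simp only [hreal] at h
  norm_cast at h
  have e : B (L (a • x + (1 - a) • y)) = a • B (L x) + (1 - a) • B (L y) := by simp
  rw [e, norm_sq_convexCombination _ _ (by ring)] at h
  rw [map_sub, map_sub]
  linarith

/-- The surplus `μ (a b / 2) ‖B L (x - y)‖²` gained from `f ∘ A` cancels the defect in the concavity
of the envelope. -/
theorem OverallConvexity.convex_sublevel (hC1 : OverallConvexity f A μ B L) (hf : IsGammaZero f)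
    (hfdom : dom f = Set.univ) (hΨ : IsGammaZero Ψ) (hb : IsBoundedBelow Ψ) (hμ : 0 < μ) (c : ℝ) :
    Convex ℝ {x | cost f A μ Ψ B L x ≤ c} := by
  refine convex_iff_forall_pos.2 fun x hx y hy a b ha hb' hab => ?_
  rw [Set.mem_ofPred_eq] at hx hy
  have hdx := mem_dom_of_cost_lt_top hf hΨ hμ hb (hx.trans_lt (EReal.coe_lt_top c))
  have hdy := mem_dom_of_cost_lt_top hf hΨ hμ hb (hy.trans_lt (EReal.coe_lt_top c))
  have hL : L (a • x + b • y) = a • L x + b • L y := by simp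
  have hΨle := hΨ.le_toReal hdx hdy ha (by linarith)
  rw [show 1 - a = b by linarith] at hΨle
  have hd : L (a • x + b • y) ∈ dom Ψ := hL ▸ hΨle.trans_lt (EReal.coe_lt_top _)
  rw [cost_eq_coe hf hfdom hΨ hb hdx, EReal.coe_le_coe_iff] at hx
  rw [cost_eq_coe hf hfdom hΨ hb hdy, EReal.coe_le_coe_iff] at hy
  rw [Set.mem_ofPred_eq, cost_eq_coe hf hfdom hΨ hb hd, EReal.coe_le_coe_iff, hL]
  have h1 := hC1.toReal_le hf hfdom x y ha hb' hab
  have h2 := mul_le_mul_of_nonneg_left (hΨ.toReal_le hΨle) hμ.le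
  have h3 := mul_le_mul_of_nonneg_left
    (hΨ.moreauEnvelope_concave (B := B) hb (L x) (L y) ha.le hb'.le hab) hμ.le
  have h4 := mul_le_mul_of_nonneg_left hx ha.le
  have h5 := mul_le_mul_of_nonneg_left hy hb'.le
  rw [← map_sub L] at h3
  have h6 : a * c + b * c = c := by rw [← add_mul, hab, one_mul]
  linarith

/-- If `f` is bounded below and the cost is bounded above on a ray with direction `d`, then
`L d = 0`, and `f ∘ A` is bounded above on that ray. -/
theorem OverallConvexity.ray_of_cost_le (hC1 : OverallConvexity f A μ B L) (hf : IsGammaZero f)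
    (hfdom : dom f = Set.univ) (hfb : IsBoundedBelow f) (hΨ : IsGammaZero Ψ)
    (hΨc : IsCoercive Ψ) (hμ : 0 < μ) {x d : X} {c : ℝ}
    (h : ∀ t : ℝ, 0 ≤ t → cost f A μ Ψ B L (x + t • d) ≤ c) :
    L d = 0 ∧ ∀ t : ℝ, 0 ≤ t → f (A x + t • A d) ≤ c := by
  have hb := hΨ.isBoundedBelow hΨc
  obtain ⟨m, hm⟩ := hfb
  have hfr : ∀ y, ((f y).toReal : EReal) = f y := fun y => hf.coe_toReal (hfdom ▸ Set.mem_univ y)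
  have hmr : ∀ y, m ≤ (f y).toReal := fun y => by
    rw [← EReal.coe_le_coe_iff, hfr]
    exact hm y
  have hd : ∀ t : ℝ, 0 ≤ t → L (x + t • d) ∈ dom Ψ := fun t ht =>
    mem_dom_of_cost_lt_top hf hΨ hμ hb ((h t ht).trans_lt (EReal.coe_lt_top c))
  have hr : ∀ t : ℝ, 0 ≤ t → (f (A (x + t • d))).toReal + μ * ((Ψ (L (x + t • d))).toReal -
      (moreauEnvelope Ψ B (L (x + t • d))).toReal) ≤ c := fun t ht => by
    have := h t ht
    rwa [cost_eq_coe hf hfdom hΨ hb (hd t ht), EReal.coe_le_coe_iff] at this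
  have hfle : ∀ t : ℝ, 0 ≤ t → (f (A (x + t • d))).toReal ≤ c := fun t ht => by
    have h1 := hΨ.moreauEnvelope_toReal_le (B := B) hb (L (x + t • d)) (hd t ht)
    simp only [sub_self, map_zero, norm_zero] at h1
    have h2 := mul_nonneg hμ.le (sub_nonneg.2 h1)
    have h3 := hr t ht
    linarith
  have hBL : B (L d) = 0 := by
    by_contra hne
    have hpos : 0 < μ / 8 * ‖B (L d)‖ ^ 2 := by positivity
    -- At the midpoint of `x` and `x + t • d`, strong convexity gives `m ≤ c - (μ/8) t² ‖B (L d)‖²`.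
    -- This `t` violates it, since `t ≤ t²`.
    obtain ⟨t, ht⟩ := exists_gt (max 1 ((c - m) / (μ / 8 * ‖B (L d)‖ ^ 2)))
    have ht1 : 1 < t := (le_max_left _ _).trans_lt ht
    have ht2 := (div_lt_iff₀ hpos).1 ((le_max_right _ _).trans_lt ht)
    have h1 := hC1.toReal_le hf hfdom x (x + t • d) (a := 1 / 2) (b := 1 / 2) (by norm_num)
      (by norm_num) (by norm_num)
    have h2 := hfle 0 le_rfl
    rw [zero_smul, add_zero] at h2
    have h3 := hfle t (by linarith)
    have h4 : ‖B (L (x - (x + t • d)))‖ ^ 2 = t ^ 2 * ‖B (L d)‖ ^ 2 := by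
      rw [sub_add_cancel_left, map_neg, map_neg, norm_neg, map_smul, map_smul, norm_smul, mul_pow,
        Real.norm_eq_abs, sq_abs]
    rw [h4] at h1
    have h5 := hmr (A ((1 / 2 : ℝ) • x + (1 / 2 : ℝ) • (x + t • d)))
    have h6 : t * (μ / 8 * ‖B (L d)‖ ^ 2) ≤ t ^ 2 * (μ / 8 * ‖B (L d)‖ ^ 2) :=
      mul_le_mul_of_nonneg_right (by nlinarith) hpos.le
    linarith
  refine ⟨?_, fun t ht => ?_⟩
  -- Since `B (L d) = 0`, the envelope is constant along the ray; with `f` at least `m`, the bound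
  -- on the cost then bounds `Ψ` on the image ray.
  · refine hΨ.eq_zero_of_ray_le hΨc (x := L x) (d := L d)
      (c := (c - m) / μ + (moreauEnvelope Ψ B (L x)).toReal) fun t ht => ?_
    have e : L (x + t • d) = L x + t • L d := by simp
    rw [← e, ← hΨ.coe_toReal (hd t ht), EReal.coe_le_coe_iff]
    have h1 := hr t ht
    have h2 : moreauEnvelope Ψ B (L (x + t • d)) = moreauEnvelope Ψ B (L x) :=
      moreauEnvelope_congr (by simp [hBL])
    rw [h2] at h1
    have h3 := hmr (A (x + t • d))
    rw [← sub_le_iff_le_add, le_div_iff₀ hμ]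
    linarith
  · rw [← map_smul, ← map_add, ← hfr, EReal.coe_le_coe_iff]
    exact hfle t ht

end Cost

end CLiGME

/-! ### The existence theorem -/

theorem theorem3p3
    {X Y Z W V : Type*}
    [NormedAddCommGroup X] [InnerProductSpace ℝ X] [FiniteDimensional ℝ X]
    [NormedAddCommGroup Y] [InnerProductSpace ℝ Y] [FiniteDimensional ℝ Y]
    [NormedAddCommGroup Z] [InnerProductSpace ℝ Z] [FiniteDimensional ℝ Z]
    [NormedAddCommGroup W] [InnerProductSpace ℝ W] [FiniteDimensional ℝ W]
    [NormedAddCommGroup V] [InnerProductSpace ℝ V] [FiniteDimensional ℝ V]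
    (A : X →ₗ[ℝ] Y) (f : Y → EReal)
    (hf : CLiGME.IsGammaZero f) (hfdom : CLiGME.dom f = Set.univ)
    (Ψ : Z → EReal) (hΨ : CLiGME.IsGammaZero Ψ) (hΨc : CLiGME.IsCoercive Ψ)
    (μ : ℝ) (hμ : 0 < μ) (L : X →ₗ[ℝ] Z) (B : Z →ₗ[ℝ] W)
    (Δ : Set V) (hΔclosed : IsClosed Δ) (hΔconvex : Convex ℝ Δ) (C : X →ₗ[ℝ] V)
    (hfeas : (CLiGME.dom (fun x => Ψ (L x)) ∩ C ⁻¹' Δ).Nonempty)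
    (hC1 : CLiGME.OverallConvexity f A μ B L)
    (hcond :
      (CLiGME.IsCoercive f ∧ CLiGME.IsAsymptoticallyMultipolyhedral (C ⁻¹' Δ)) ∨
      (CLiGME.IsCoercive f ∧ LinearMap.ker A ⊓ LinearMap.ker L = ⊥) ∨
      (CLiGME.IsBoundedBelow f ∧ LinearMap.ker L = ⊥) ∨
      Bornology.IsBounded (C ⁻¹' Δ)) :
    ∃ x ∈ C ⁻¹' Δ, IsMinOn (CLiGME.cost f A μ Ψ B L) (C ⁻¹' Δ) x := by
  have hΨb := hΨ.isBoundedBelow hΨc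
  obtain ⟨x₀, hx₀dom, hx₀⟩ := hfeas
  have hcost := CLiGME.cost_eq_coe (A := A) (μ := μ) (B := B) hf hfdom hΨ hΨb hx₀dom
  have hD : Convex ℝ (C ⁻¹' Δ) := hΔconvex.linear_preimage C
  have hDclosed : IsClosed (C ⁻¹' Δ) := hΔclosed.preimage C.continuous_of_finiteDimensional
  have hlsc := CLiGME.lowerSemicontinuous_cost (A := A) (L := L) (B := B) hf hΨ hμ hΨb
  have hconv : Convex ℝ {x | CLiGME.cost f A μ Ψ B L x ≤ CLiGME.cost f A μ Ψ B L x₀} :=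
    hcost ▸ hC1.convex_sublevel hf hfdom hΨ hΨb hμ _
  have hray (hfb : CLiGME.IsBoundedBelow f) {d : X} (h : ∀ t : ℝ, 0 ≤ t →
      CLiGME.cost f A μ Ψ B L (x₀ + t • d) ≤ CLiGME.cost f A μ Ψ B L x₀) :=
    hC1.ray_of_cost_le hf hfdom hfb hΨ hΨc hμ (hcost ▸ h)
  have main_coercive (hfc : CLiGME.IsCoercive f)
      (hcl : IsClosed (C ⁻¹' Δ + ((LinearMap.ker A ⊓ LinearMap.ker L : Submodule ℝ X) : Set X))) :
      ∃ x ∈ C ⁻¹' Δ, IsMinOn (CLiGME.cost f A μ Ψ B L) (C ⁻¹' Δ) x := by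
    refine CLiGME.exists_isMinOn_of_ray hlsc (LinearMap.ker A ⊓ LinearMap.ker L) ?_ hD hcl hx₀
      hconv fun d hd _ h => ?_
    · rintro x n ⟨hA, hL⟩
      simp [CLiGME.cost, LinearMap.mem_ker.1 hA, LinearMap.mem_ker.1 hL]
    · obtain ⟨hLd, hAd⟩ := hray (hf.isBoundedBelow hfc) h
      -- Coercivity of `f` gives `A d = 0`, so `d` lies both in `ker A ⊓ ker L` and in its
      -- orthogonal complement.
      exact Submodule.disjoint_def.1 (Submodule.orthogonal_disjoint _) d
        (Submodule.mem_inf.2 ⟨hf.eq_zero_of_ray_le hfc hAd, hLd⟩) hd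
  have main_closed (h : ∀ d : X, (∀ t : ℝ, 0 ≤ t → x₀ + t • d ∈ C ⁻¹' Δ) →
      (∀ t : ℝ, 0 ≤ t → CLiGME.cost f A μ Ψ B L (x₀ + t • d) ≤ CLiGME.cost f A μ Ψ B L x₀) →
      d = 0) : ∃ x ∈ C ⁻¹' Δ, IsMinOn (CLiGME.cost f A μ Ψ B L) (C ⁻¹' Δ) x :=
    CLiGME.exists_isMinOn_of_ray hlsc ⊥ (by simp) hD (by simpa using hDclosed) hx₀ hconv
      fun d _ h₁ h₂ => h d (by simpa using h₁) h₂
  rcases hcond with ⟨hfc, hDp⟩ | ⟨hfc, hker⟩ | ⟨hfb, hker⟩ | hbdd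
  · exact main_coercive hfc (hDp.isClosed_add_submodule _)
  · exact main_coercive hfc (by simpa [hker] using hDclosed)
  · refine main_closed fun d _ h => ?_
    exact LinearMap.ker_eq_bot'.1 hker d (hray hfb h).1
  · refine main_closed fun d h _ => ?_
    by_contra hd
    obtain ⟨r, hr⟩ := hbdd.subset_closedBall x₀
    -- Beyond `r / ‖d‖` the ray leaves the ball of radius `r` about `x₀`.
    obtain ⟨t, ht⟩ := exists_gt (max 0 (r / ‖d‖))
    have ht0 : 0 < t := (le_max_left _ _).trans_lt ht
    have h1 := (div_lt_iff₀ (norm_pos_iff.2 hd)).1 ((le_max_right _ _).trans_lt ht)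
    have h2 := hr (h t ht0.le)
    rw [mem_closedBall_iff_norm, add_sub_cancel_left, norm_smul, Real.norm_of_nonneg ht0.le] at h2
    exact h1.not_ge h2
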